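/- Let $n\ge 1$, let $\mathbb{B}^n=\{z\in\mathbb{C}^n:|z|<1\}$ be the Euclidean unit ball with normalized Lebesgue volume measure $dV_N$ (so that $V_N(\mathbb{B}^n)=1$), let $d(z)$ be the Euclidean distance from $z$ to $\partial\mathbb{B}^n$, and let $\Delta=4\sum_{k=1}^n\frac{\partial^2}{\partial z_k\,\partial\overline{z}_k}=\sum_{k=1}^n\Big(\frac{\partial^2}{\partial x_k^2}+\frac{\partial^2}{\partial y_k^2}\Big)$ be the Laplacian, where $z_k=x_k+iy_k$. For real $\nu>-1$ and $0<\mu<\infty$, the Bergman-type space $b_{\nu,\mu}(\mathbb{B}^n)$ consists of all continuous functions $f:\mathbb{B}^n\to\mathbb{C}$ with $$\|f\|_{b_{\nu,\mu}}=|f(0)|+\Big(\int_{\mathbb{B}^n}d(z)^{\nu}\,|f(z)|^{\mu}\,dV_N(z)\Big)^{1/\mu}<\infty .$$ **Theorem.** Let $f\in\mathcal{C}^2(\mathbb{B}^n)$ be complex-valued with $\operatorname{Re}\big(f\,\overline{\Delta f}\big)\ge 0$ in $\mathbb{B}^n$, and let $p\ge 2$ and $\alpha\ge 2$ be real numbers.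 Then $$\int_{\mathbb{B}^n}(1-|z|^2)^{\alpha}\,\Delta\big(|f(z)|^p\big)\,dV_N(z)<\infty$$ (that is, the integrand is Lebesgue integrable on $\mathbb{B}^n$) if and only if $f\in b_{\alpha-2,p}(\mathbb{B}^n)$. -/

import Mathlib

open Metric MeasureTheory
open scoped ENNReal Laplacian ComplexConjugate

/-- The open unit ball `𝔹ⁿ` of `ℂⁿ`, with the Euclidean norm. -/
def unitBall (n : ℕ) : Set (EuclideanSpace ℂ (Fin n)) := ball 0 1

/-- The normalized Lebesgue volume measure `V_N` on `𝔹ⁿ` (total mass one). -/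
noncomputable def normVol (n : ℕ) : Measure (EuclideanSpace ℂ (Fin n)) :=
  (volume (unitBall n))⁻¹ • volume.restrict (unitBall n)

/-- The Euclidean distance `d(z)` from `z` to the boundary of `𝔹ⁿ`. -/
noncomputable def bdryDist {n : ℕ} (z : EuclideanSpace ℂ (Fin n)) : ℝ :=
  infDist z (frontier (unitBall n))

/-- The quantity `‖f‖_{b_{ν,μ}} = |f(0)| + (∫_{𝔹ⁿ} d(z)^ν |f(z)|^μ dV_N(z))^{1/μ}`,
as an element of `[0, ∞]`. -/
noncomputable def bergmanNorm {n : ℕ} (ν μ : ℝ) (f : EuclideanSpace ℂ (Fin n) → ℂ) : ℝ≥0∞ :=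
  ENNReal.ofReal ‖f 0‖ +
    (∫⁻ z, ENNReal.ofReal (bdryDist z ^ ν * ‖f z‖ ^ μ) ∂(normVol n)) ^ (1 / μ)

/-- The Bergman-type space `b_{ν,μ}(𝔹ⁿ)`, intended for `ν > -1` and `0 < μ < ∞`: the functions
that are continuous on `𝔹ⁿ` and have finite norm. Values outside `𝔹ⁿ` play no role. -/
def bergmanSpace (n : ℕ) (ν μ : ℝ) : Set (EuclideanSpace ℂ (Fin n) → ℂ) :=
  {f | ContinuousOn f (unitBall n) ∧ bergmanNorm ν μ f < ∞}

open Filter Topology Asymptotics InnerProductSpace Module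

/-! ### Second derivatives and the Laplacian in an orthonormal basis. -/

section Laplacian

variable {E : Type*} [NormedAddCommGroup E] [InnerProductSpace ℝ E]
  {F : Type*} [NormedAddCommGroup F] [NormedSpace ℝ F]

/-! Put `u = ‖f‖ ^ p`. As `p ≥ 2`, `u` is `C²` even at the zeros of `f`, and the sign condition on
`f` makes it subharmonic (`ContDiffAt.laplacian_norm_rpow_nonneg`). Green's formula moves the
Laplacian from `u` onto a weight `(c - |z|²)₊ ^ β` with `c < 1` and `β` slightly above `α`: compact
support in the ball removes boundary terms, and `β > 2` makes the weight `C²`. The Laplacian of the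
weight is comparable to `(c - |z|²)₊ ^ (β - 2)`, up to a constant in the upper bound and an error on
a fixed compact set in the lower one (`laplacian_sub_norm_sq_rpow_le`,
`rpow_le_laplacian_sub_norm_sq_rpow_add`). Since `u` and `Δ u` are nonnegative, Fatou's lemma as `c
→ 1`, `β → α` transfers integrability both ways (`integrableOn_rpow_mul_laplacian_iff`). Finally `1
- |z|²` is comparable to `d(z) = 1 - |z|`. -/

theorem ContDiffAt.differentiableAt_fderiv {u : E → F} {z : E} (hu : ContDiffAt ℝ 2 u z) :
    DifferentiableAt ℝ (fderiv ℝ u) z :=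
  (hu.fderiv_right (m := 1) (by norm_num)).differentiableAt one_ne_zero

theorem ContDiffAt.fderiv_fderiv_apply {u : E → F} {z : E} (hu : ContDiffAt ℝ 2 u z) (v w : E) :
    fderiv ℝ (fun y => fderiv ℝ u y v) z w = fderiv ℝ (fderiv ℝ u) z w v := by
  rw [fderiv_clm_apply hu.differentiableAt_fderiv (differentiableAt_const v)]
  simp

theorem ContDiffAt.laplacian_eq_sum_fderiv [FiniteDimensional ℝ E] {u : E → F} {z : E}
    (hu : ContDiffAt ℝ 2 u z) {ι : Type*} [Fintype ι] (b : OrthonormalBasis ι ℝ E) :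
    Δ u z = ∑ i, fderiv ℝ (fun y => fderiv ℝ u y (b i)) z (b i) := by
  rw [congrFun (laplacian_eq_iteratedFDeriv_orthonormalBasis u b) z]
  refine Finset.sum_congr rfl fun i _ => ?_
  rw [iteratedFDeriv_two_apply, hu.fderiv_fderiv_apply]
  simp

theorem ContDiffOn.continuousOn_laplacian [FiniteDimensional ℝ E] {u : E → F} {s : Set E}
    (hu : ContDiffOn ℝ 2 u s) (hs : IsOpen s) : ContinuousOn (Δ u) s := by
  have h1 : ContDiffOn ℝ 1 (fderiv ℝ u) s := hu.fderiv_of_isOpen hs (by norm_num)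
  have h2 : ContinuousOn (fderiv ℝ (fderiv ℝ u)) s := h1.continuousOn_fderiv_of_isOpen hs le_rfl
  have h3 : ContinuousOn (fun z => ∑ i, fderiv ℝ (fderiv ℝ u) z (stdOrthonormalBasis ℝ E i)
      (stdOrthonormalBasis ℝ E i)) s := by fun_prop
  refine h3.congr fun z hz => ?_
  have hz' := hu.contDiffAt (hs.mem_nhds hz)
  rw [hz'.laplacian_eq_sum_fderiv (stdOrthonormalBasis ℝ E)]
  exact Finset.sum_congr rfl fun i _ => hz'.fderiv_fderiv_apply _ _

end Laplacian

/-! ### Smoothness and subharmonicity of powers of the norm. -/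

section NormRpow

variable {E : Type*} [NormedAddCommGroup E] [InnerProductSpace ℝ E]

theorem hasFDerivAt_norm_rpow_smul (x : E) {q : ℝ} (hq : 0 < q) :
    HasFDerivAt (fun x : E => ‖x‖ ^ q • x)
      (‖x‖ ^ q • ContinuousLinearMap.id ℝ E +
        (q * ‖x‖ ^ (q - 2)) • (innerSL ℝ x).smulRight x) x := by
  by_cases hx : x = 0
  · subst hx
    -- At the origin `innerSL ℝ 0 = 0` kills the term with the possibly negative exponent `q - 2`,
    -- so the claimed derivative is zero.
    simp only [norm_zero, Real.zero_rpow hq.ne', zero_smul, map_zero, zero_add]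
    refine .of_isLittleO ?_
    have h0 : Tendsto (fun x : E => ‖x‖ ^ q) (𝓝 0) (𝓝 0) := by
      have : ContinuousAt (fun x : E => ‖x‖ ^ q) 0 :=
        continuousAt_id.norm.rpow_const (.inr hq.le)
      simpa [ContinuousAt, Real.zero_rpow hq.ne'] using this
    have := ((isLittleO_one_iff ℝ).2 h0).smul_isBigO (isBigO_refl (fun x : E => x) (𝓝 0))
    simpa [Real.zero_rpow hq.ne'] using this
  · have h1 : HasFDerivAt (fun x : E => ‖x‖ ^ q) ((q * ‖x‖ ^ (q - 2)) • innerSL ℝ x) x := by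
      apply HasStrictFDerivAt.hasFDerivAt
      convert! (hasStrictFDerivAt_norm_sq x).rpow_const (p := q / 2) (by simp [hx]) using 0
      simp_rw [← Real.rpow_natCast_mul (norm_nonneg _), ← Nat.cast_smul_eq_nsmul ℝ, smul_smul]
      ring_nf
    refine (h1.smul (hasFDerivAt_id x)).congr_fderiv ?_
    ext y
    simp [smul_smul, mul_assoc]

/-- With `q = p - 2` this map is, up to the factor `p`, the gradient of `‖x‖ ^ p`. Its derivative
has norm at most `(1 + q) * ‖x‖ ^ q`, which gives continuity at the origin. -/
theorem contDiff_norm_rpow_smul {q : ℝ} (hq : 0 ≤ q) :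
    ContDiff ℝ 1 (fun x : E => ‖x‖ ^ q • x) := by
  rcases hq.eq_or_lt with rfl | hq
  · simp only [Real.rpow_zero, one_smul]
    exact contDiff_id
  rw [contDiff_one_iff_hasFDerivAt]
  refine ⟨_, ?_, fun x => hasFDerivAt_norm_rpow_smul x hq⟩
  rw [continuous_iff_continuousAt]
  intro x
  by_cases hx : x = 0
  · subst hx
    simp only [ContinuousAt, norm_zero, Real.zero_rpow hq.ne', zero_smul, map_zero, zero_add,
      ContinuousLinearMap.smulRight_zero, smul_zero]
    have hc : ContinuousAt (fun x : E => (1 + q) * ‖x‖ ^ q) 0 :=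
      (continuousAt_id.norm.rpow_const (.inr hq.le)).const_mul _
    have hc' : Tendsto (fun x : E => (1 + q) * ‖x‖ ^ q) (𝓝 0) (𝓝 0) := by
      simpa [ContinuousAt, Real.zero_rpow hq.ne'] using hc
    refine squeeze_zero_norm (fun y => ?_) hc'
    refine (ContinuousLinearMap.opNorm_le_bound _ (by positivity) fun w => ?_)
    have hy : ‖y‖ ^ (q - 2) * ‖y‖ ^ 2 = ‖y‖ ^ q := by
      rw [← Real.rpow_add_natCast' (norm_nonneg y) (by simpa using hq.ne')]
      norm_num
    calc _ ≤ ‖‖y‖ ^ q • w‖ + ‖(q * ‖y‖ ^ (q - 2)) • (inner ℝ y w • y)‖ := by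
          simpa using norm_add_le (‖y‖ ^ q • w) ((q * ‖y‖ ^ (q - 2)) • (inner ℝ y w • y))
      _ ≤ ‖y‖ ^ q * ‖w‖ + (q * ‖y‖ ^ (q - 2)) * ((‖y‖ * ‖w‖) * ‖y‖) := by
          rw [norm_smul, norm_smul, norm_smul, Real.norm_of_nonneg (by positivity),
            Real.norm_of_nonneg (by positivity)]
          gcongr
          exact norm_inner_le_norm y w
      _ = (1 + q) * ‖y‖ ^ q * ‖w‖ := by
          rw [← hy]; ring
  · have h1 : Continuous fun x : E => (innerSL ℝ x).smulRight x :=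
      isBoundedBilinearMap_smulRight.continuous.comp
        ((innerSL ℝ).continuous.prodMk continuous_id)
    exact ((continuousAt_id.norm.rpow_const (.inl (by simpa))).smul continuousAt_const).add
      ((continuousAt_const.mul (continuousAt_id.norm.rpow_const (.inl (by simpa)))).smul
        h1.continuousAt)

theorem contDiff_two_norm_rpow {p : ℝ} (hp : 2 ≤ p) : ContDiff ℝ 2 (fun x : E => ‖x‖ ^ p) := by
  refine (contDiff_succ_iff_fderiv (n := 1)).2
    ⟨differentiable_norm_rpow (by linarith), by simp, ?_⟩
  have h : (fderiv ℝ fun x : E => ‖x‖ ^ p) = fun x => p • innerSL ℝ (‖x‖ ^ (p - 2) • x) := by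
    ext x : 1
    rw [fderiv_norm_rpow x (by linarith), map_smul, smul_smul]
  rw [h]
  exact ((innerSL ℝ).contDiff.comp (contDiff_norm_rpow_smul (by linarith))).const_smul p

/-- This is convexity of `‖x‖ ^ (q + 2)`: its Hessian is a positive multiple of the form here. -/
theorem inner_fderiv_norm_rpow_smul_nonneg {q : ℝ} (hq : 0 ≤ q) (x h : E) :
    0 ≤ inner ℝ (fderiv ℝ (fun x : E => ‖x‖ ^ q • x) x h) h := by
  rcases hq.eq_or_lt with rfl | hq
  · simp
  rw [(hasFDerivAt_norm_rpow_smul x hq).fderiv]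
  have : inner ℝ ((‖x‖ ^ q • ContinuousLinearMap.id ℝ E +
      (q * ‖x‖ ^ (q - 2)) • (innerSL ℝ x).smulRight x) h) h =
      ‖x‖ ^ q * ‖h‖ ^ 2 + q * ‖x‖ ^ (q - 2) * inner ℝ x h ^ 2 := by
    simp only [add_apply, smul_apply, ContinuousLinearMap.id_apply,
      ContinuousLinearMap.smulRight_apply, innerSL_apply_apply, inner_add_left,
      real_inner_smul_left, real_inner_self_eq_norm_sq]
    ring
  rw [this]
  positivity

variable {F : Type*} [NormedAddCommGroup F] [InnerProductSpace ℝ F]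

/-- Keeping `‖x‖ ^ (p - 2) • x` whole, as a `C¹` map, avoids a case split at the zeros of `f`. -/
theorem ContDiffAt.fderiv_fderiv_norm_rpow {f : E → F} {z : E} (hf : ContDiffAt ℝ 2 f z) {p : ℝ}
    (hp : 2 ≤ p) (v : E) :
    fderiv ℝ (fun y => fderiv ℝ (fun w => ‖f w‖ ^ p) y v) z v =
      p * (⟪fderiv ℝ (fun x : F => ‖x‖ ^ (p - 2) • x) (f z) (fderiv ℝ f z v),
          fderiv ℝ f z v⟫_ℝ
        + ‖f z‖ ^ (p - 2) * ⟪f z, fderiv ℝ (fun y => fderiv ℝ f y v) z v⟫_ℝ) := by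
  have hev : (fun y => fderiv ℝ (fun w => ‖f w‖ ^ p) y v) =ᶠ[𝓝 z]
      fun y => p * ⟪‖f y‖ ^ (p - 2) • f y, fderiv ℝ f y v⟫_ℝ := by
    filter_upwards [hf.eventually (by simp)] with y hy
    have := ((hasFDerivAt_norm_rpow (f y) (p := p) (by linarith)).comp y
      (hy.differentiableAt two_ne_zero).hasFDerivAt).fderiv
    simp only [Function.comp_def] at this
    rw [this]
    simp [inner_smul_left, mul_assoc]
  rw [hev.fderiv_eq]
  have hG : HasFDerivAt (fun y => ‖f y‖ ^ (p - 2) • f y)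
      ((fderiv ℝ (fun x : F => ‖x‖ ^ (p - 2) • x) (f z)).comp (fderiv ℝ f z)) z :=
    ((((contDiff_norm_rpow_smul (E := F) (q := p - 2) (by linarith)).differentiable
      one_ne_zero) (f z)).hasFDerivAt).comp z (hf.differentiableAt two_ne_zero).hasFDerivAt
  have hD : DifferentiableAt ℝ (fun y => fderiv ℝ f y v) z :=
    hf.differentiableAt_fderiv.clm_apply (differentiableAt_const v)
  have := ((hG.inner ℝ hD.hasFDerivAt).const_mul p).fderiv
  rw [this]
  simp only [smul_apply, ContinuousLinearMap.comp_apply, ContinuousLinearMap.prod_apply,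
    fderivInnerCLM_apply, real_inner_smul_left, smul_eq_mul]
  ring

theorem ContDiffAt.laplacian_norm_rpow_nonneg [FiniteDimensional ℝ E] {f : E → F} {z : E}
    (hf : ContDiffAt ℝ 2 f z) {p : ℝ} (hp : 2 ≤ p) (hΔ : 0 ≤ ⟪f z, Δ f z⟫_ℝ) :
    0 ≤ Δ (fun w => ‖f w‖ ^ p) z := by
  have hu : ContDiffAt ℝ 2 (fun w => ‖f w‖ ^ p) z :=
    (contDiff_two_norm_rpow hp).contDiffAt.comp z hf
  rw [hu.laplacian_eq_sum_fderiv (stdOrthonormalBasis ℝ E)]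
  rw [hf.laplacian_eq_sum_fderiv (stdOrthonormalBasis ℝ E), inner_sum] at hΔ
  simp_rw [hf.fderiv_fderiv_norm_rpow hp]
  rw [← Finset.mul_sum, Finset.sum_add_distrib, ← Finset.mul_sum]
  refine mul_nonneg (by linarith) (add_nonneg (Finset.sum_nonneg fun i _ => ?_) (by positivity))
  exact inner_fderiv_norm_rpow_smul_nonneg (by linarith) _ _

end NormRpow

/-! ### Green's formula against a compactly supported weight. -/

section Green

variable {E : Type*} [NormedAddCommGroup E]

theorem Continuous.mul_continuousOn_of_tsupport_subset {φ h : E → ℝ} {U : Set E}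
    (hφ : Continuous φ) (hU : IsOpen U) (hs : tsupport φ ⊆ U) (hh : ContinuousOn h U) :
    Continuous fun x => φ x * h x :=
  continuous_of_tsupport fun _ hx => hφ.continuousAt.mul
    (hh.continuousAt (hU.mem_nhds (hs (tsupport_mul_subset_left hx))))

variable [MeasurableSpace E] [BorelSpace E]

theorem Continuous.integrable_mul_of_tsupport_subset {φ h : E → ℝ} {U : Set E} {μ : Measure E}
    [IsFiniteMeasureOnCompacts μ] (hφ : Continuous φ) (hc : HasCompactSupport φ) (hU : IsOpen U)
    (hs : tsupport φ ⊆ U) (hh : ContinuousOn h U) : Integrable (fun x => φ x * h x) μ :=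
  (hφ.mul_continuousOn_of_tsupport_subset hU hs hh).integrable_of_hasCompactSupport hc.mul_right

variable [InnerProductSpace ℝ E] [FiniteDimensional ℝ E]

theorem integral_mul_fderiv_eq_of_tsupport_subset {φ u : E → ℝ} {U : Set E} {μ : Measure E}
    [μ.IsAddHaarMeasure] (hφ : ContDiff ℝ 1 φ) (hc : HasCompactSupport φ) (hU : IsOpen U)
    (hs : tsupport φ ⊆ U) (hu : ContDiffOn ℝ 1 u U) (v : E) :
    ∫ x, φ x * fderiv ℝ u x v ∂μ = - ∫ x, fderiv ℝ φ x v * u x ∂μ := by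
  have hs' := (tsupport_fderiv_apply_subset ℝ (f := φ) v).trans hs
  refine integral_mul_fderiv_eq_neg_fderiv_mul_of_integrable ?_ ?_ ?_ ?_ ?_
  · exact ((hφ.continuous_fderiv one_ne_zero).clm_apply
      continuous_const).integrable_mul_of_tsupport_subset (hc.fderiv_apply ℝ v) hU hs'
      hu.continuousOn
  · exact hφ.continuous.integrable_mul_of_tsupport_subset hc hU hs
      ((hu.continuousOn_fderiv_of_isOpen hU le_rfl).clm_apply continuousOn_const)
  · exact hφ.continuous.integrable_mul_of_tsupport_subset hc hU hs hu.continuousOn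
  · exact fun x _ => (hφ.differentiable one_ne_zero) x
  · exact fun x hx => (hu.differentiableOn one_ne_zero).differentiableAt (hU.mem_nhds (hs hx))

/-- Two integrations by parts in each coordinate direction. Outside `U` the factor `φ` vanishes, so
the values of `u` and `Δ u` there are irrelevant. -/
theorem integral_mul_laplacian_of_tsupport_subset {φ u : E → ℝ} {U : Set E} {μ : Measure E}
    [μ.IsAddHaarMeasure] (hφ : ContDiff ℝ 2 φ) (hc : HasCompactSupport φ) (hU : IsOpen U)
    (hs : tsupport φ ⊆ U) (hu : ContDiffOn ℝ 2 u U) :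
    ∫ x, φ x * Δ u x ∂μ = ∫ x, Δ φ x * u x ∂μ := by
  set b := stdOrthonormalBasis ℝ E
  have hu1 (v : E) : ContDiffOn ℝ 1 (fun y => fderiv ℝ u y v) U :=
    (hu.fderiv_of_isOpen hU (by norm_num)).clm_apply contDiffOn_const
  have hφ1 (v : E) : ContDiff ℝ 1 (fun y => fderiv ℝ φ y v) :=
    (hφ.fderiv_right (by norm_num)).clm_apply contDiff_const
  have hsv (v : E) := (tsupport_fderiv_apply_subset ℝ (f := φ) v).trans hs
  have hcv (v : E) := hc.fderiv_apply ℝ v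
  have hl : ∀ x, φ x * Δ u x = ∑ i, φ x * fderiv ℝ (fun y => fderiv ℝ u y (b i)) x (b i) := by
    intro x
    by_cases hx : x ∈ U
    · rw [(hu.contDiffAt (hU.mem_nhds hx)).laplacian_eq_sum_fderiv b, Finset.mul_sum]
    · simp [image_eq_zero_of_notMem_tsupport fun h => hx (hs h)]
  have hr : ∀ x, Δ φ x * u x = ∑ i, fderiv ℝ (fun y => fderiv ℝ φ y (b i)) x (b i) * u x := by
    intro x
    rw [hφ.contDiffAt.laplacian_eq_sum_fderiv b, Finset.sum_mul]
  simp_rw [hl, hr]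
  rw [integral_finsetSum _ fun i _ => hφ.continuous.integrable_mul_of_tsupport_subset hc hU hs
      (((hu1 (b i)).continuousOn_fderiv_of_isOpen hU le_rfl).clm_apply continuousOn_const),
    integral_finsetSum _ fun i _ => (((hφ1 (b i)).continuous_fderiv one_ne_zero).clm_apply
      continuous_const).integrable_mul_of_tsupport_subset ((hcv _).fderiv_apply ℝ _) hU
      ((tsupport_fderiv_apply_subset ℝ _).trans (hsv _)) hu.continuousOn]
  refine Finset.sum_congr rfl fun i _ => ?_
  rw [integral_mul_fderiv_eq_of_tsupport_subset (hφ.of_le (by norm_num)) hc hU hs (hu1 (b i)),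
    integral_mul_fderiv_eq_of_tsupport_subset (hφ1 (b i)) (hcv _) hU (hsv _)
      (hu.of_le (by norm_num)), neg_neg]

end Green

/-! ### The weights `(c - |z|²)₊ ^ β` and their Laplacian. -/

section PosPartRpow

theorem hasDerivAt_max_zero_rpow {β : ℝ} (hβ : 1 < β) (t : ℝ) :
    HasDerivAt (fun t : ℝ => max t 0 ^ β) (β * max t 0 ^ (β - 1)) t := by
  rcases lt_trichotomy t 0 with ht | rfl | ht
  · have : (fun t : ℝ => max t 0 ^ β) =ᶠ[𝓝 t] fun _ => (0 : ℝ) := by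
      filter_upwards [gt_mem_nhds ht] with s hs
      rw [max_eq_right hs.le, Real.zero_rpow (by linarith)]
    rw [max_eq_right ht.le, Real.zero_rpow (by linarith), mul_zero]
    exact (hasDerivAt_const t (0 : ℝ)).congr_of_eventuallyEq this
  · rw [max_self, Real.zero_rpow (by linarith), mul_zero]
    -- The truncated power is dominated by `|t| ^ β`, whose derivative at `0` is zero.
    have h := hasDerivAt_abs_rpow 0 hβ
    rw [mul_zero, hasDerivAt_iff_isLittleO] at h
    rw [hasDerivAt_iff_isLittleO]
    refine IsBigO.trans_isLittleO (IsBigO.of_norm_le fun s => ?_) h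
    have h0 : (0 : ℝ) ^ β = 0 := Real.zero_rpow (by linarith)
    simp only [max_self, h0, abs_zero, sub_zero, smul_zero]
    refine (Real.norm_of_nonneg (by positivity)).trans_le ?_
    exact Real.rpow_le_rpow (le_max_right _ _) (max_le (le_abs_self s) (abs_nonneg s)) (by linarith)
  · have : (fun t : ℝ => max t 0 ^ β) =ᶠ[𝓝 t] fun t => t ^ β := by
      filter_upwards [lt_mem_nhds ht] with s hs
      rw [max_eq_left hs.le]
    rw [max_eq_left ht.le]
    exact (Real.hasDerivAt_rpow_const (.inl ht.ne')).congr_of_eventuallyEq this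

/-- The inequality must be strict: for `β = 2` the second derivative jumps at `0`. This is why
exponents above `α` are used later. -/
theorem contDiff_two_max_zero_rpow {β : ℝ} (hβ : 2 < β) :
    ContDiff ℝ 2 (fun t : ℝ => max t 0 ^ β) := by
  have hd {β : ℝ} (hβ : 1 < β) : deriv (fun t : ℝ => max t 0 ^ β) =
      fun t => β * max t 0 ^ (β - 1) := funext fun t => (hasDerivAt_max_zero_rpow hβ t).deriv
  have h1 {β : ℝ} (hβ : 1 < β) : ContDiff ℝ 1 (fun t : ℝ => max t 0 ^ β) := by
    refine contDiff_one_iff_deriv.2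
      ⟨fun t => (hasDerivAt_max_zero_rpow hβ t).differentiableAt, ?_⟩
    rw [hd hβ]
    exact continuous_const.mul
      ((continuous_id.max continuous_const).rpow_const fun _ => .inr (by linarith))
  refine (contDiff_succ_iff_deriv (n := 1)).2
    ⟨fun t => (hasDerivAt_max_zero_rpow (by linarith) t).differentiableAt, by simp, ?_⟩
  rw [hd (by linarith)]
  exact contDiff_const.mul (h1 (by linarith))

variable {E : Type*} [NormedAddCommGroup E] [InnerProductSpace ℝ E]

theorem contDiff_two_sub_norm_sq_rpow {β : ℝ} (hβ : 2 < β) (c : ℝ) :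
    ContDiff ℝ 2 (fun z : E => max (c - ‖z‖ ^ 2) 0 ^ β) :=
  (contDiff_two_max_zero_rpow hβ).comp (contDiff_const.sub (contDiff_norm_sq ℝ))

theorem hasFDerivAt_sub_norm_sq_rpow {β : ℝ} (hβ : 1 < β) (c : ℝ) (z : E) :
    HasFDerivAt (fun z : E => max (c - ‖z‖ ^ 2) 0 ^ β)
      ((β * max (c - ‖z‖ ^ 2) 0 ^ (β - 1)) • ((-2 : ℝ) • innerSL ℝ z)) z := by
  refine ((hasDerivAt_max_zero_rpow hβ (c - ‖z‖ ^ 2)).comp_hasFDerivAt z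
    ((hasStrictFDerivAt_norm_sq z).hasFDerivAt.const_sub c)).congr_fderiv ?_
  ext v
  simp

theorem laplacian_sub_norm_sq_rpow [FiniteDimensional ℝ E] {β : ℝ} (hβ : 2 < β) (c : ℝ) (z : E) :
    Δ (fun z : E => max (c - ‖z‖ ^ 2) 0 ^ β) z =
      4 * β * (β - 1) * max (c - ‖z‖ ^ 2) 0 ^ (β - 2) * ‖z‖ ^ 2
        - 2 * finrank ℝ E * β * max (c - ‖z‖ ^ 2) 0 ^ (β - 1) := by
  set b := stdOrthonormalBasis ℝ E
  rw [(contDiff_two_sub_norm_sq_rpow hβ c).contDiffAt.laplacian_eq_sum_fderiv b]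
  have h1 (v : E) : (fun y => fderiv ℝ (fun z : E => max (c - ‖z‖ ^ 2) 0 ^ β) y v) =
      fun y => (-2 * β) * (max (c - ‖y‖ ^ 2) 0 ^ (β - 1) * ⟪y, v⟫_ℝ) := by
    ext y
    rw [(hasFDerivAt_sub_norm_sq_rpow (by linarith) c y).fderiv]
    simp
    ring
  have h2 (v : E) : fderiv ℝ (fun y => (-2 * β) * (max (c - ‖y‖ ^ 2) 0 ^ (β - 1) * ⟪y, v⟫_ℝ)) z v =
      4 * β * (β - 1) * max (c - ‖z‖ ^ 2) 0 ^ (β - 2) * ⟪z, v⟫_ℝ ^ 2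
        - 2 * β * max (c - ‖z‖ ^ 2) 0 ^ (β - 1) * ‖v‖ ^ 2 := by
    have hi : HasFDerivAt (fun y : E => ⟪y, v⟫_ℝ) (innerSL ℝ v) z := by
      have := (innerSL ℝ v).hasFDerivAt (x := z)
      refine this.congr_of_eventuallyEq (Eventually.of_forall fun y => ?_)
      exact real_inner_comm _ _
    have := (((hasFDerivAt_sub_norm_sq_rpow (β := β - 1) (by linarith) c z).mul hi).const_mul
      (-2 * β)).fderiv
    have he : β - 1 - 1 = β - 2 := by ring
    rw [he] at this
    erw [this]
    simp only [smul_apply, add_apply, innerSL_apply_apply, smul_eq_mul,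
      real_inner_self_eq_norm_sq]
    ring
  simp_rw [h1, h2]
  rw [Finset.sum_sub_distrib, ← Finset.mul_sum, b.sum_sq_inner_left]
  simp
  ring

end PosPartRpow

/-- Fatou's lemma; no monotonicity or dominating function is needed. -/
theorem integrable_of_tendsto_of_integral_le {X : Type*} [MeasurableSpace X] {μ : Measure X}
    {g : ℕ → X → ℝ} {f : X → ℝ} (hg : ∀ k, Integrable (g k) μ) (h0 : ∀ k, 0 ≤ᵐ[μ] g k) {C : ℝ}
    (hC : ∀ k, ∫ x, g k x ∂μ ≤ C) (hlim : ∀ᵐ x ∂μ, Tendsto (fun k => g k x) atTop (𝓝 (f x))) :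
    Integrable f μ := by
  refine ⟨aestronglyMeasurable_of_tendsto_ae _ (fun k => (hg k).1) hlim, ?_⟩
  have h1 : ∫⁻ x, ‖f x‖ₑ ∂μ ≤ liminf (fun k => ∫⁻ x, ‖g k x‖ₑ ∂μ) atTop :=
    lintegral_congr_ae (by filter_upwards [hlim] with x hx using hx.enorm.liminf_eq) ▸
      lintegral_liminf_le' fun k => (hg k).1.aemeasurable.enorm
  refine h1.trans_lt (lt_of_le_of_lt ?_ (ENNReal.ofReal_lt_top (r := C)))
  refine (liminf_le_liminf (Eventually.of_forall fun k => ?_)).trans_eq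
    (liminf_const (ENNReal.ofReal C))
  have h2 : ∫⁻ x, ‖g k x‖ₑ ∂μ = ∫⁻ x, ENNReal.ofReal (g k x) ∂μ := by
    refine lintegral_congr_ae ?_
    filter_upwards [h0 k] with x hx using Real.enorm_of_nonneg hx
  rw [h2, ← ofReal_integral_eq_lintegral_ofReal (hg k) (h0 k)]
  exact ENNReal.ofReal_le_ofReal (hC k)

/-! ### Two-sided bounds for the weights, and the integrability equivalence on the ball. -/

section Ball

variable {E : Type*} [NormedAddCommGroup E]

theorem tsupport_sub_norm_sq_rpow_subset {β c : ℝ} (hβ : 0 < β) :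
    tsupport (fun z : E => max (c - ‖z‖ ^ 2) 0 ^ β) ⊆ {z | ‖z‖ ^ 2 ≤ c} := by
  refine closure_minimal (fun z hz => ?_) (isClosed_le (by fun_prop) continuous_const)
  by_contra h
  refine hz ?_
  have h' : c - ‖z‖ ^ 2 ≤ 0 := by simpa using (not_le.1 h).le
  simp only [max_eq_right h', Real.zero_rpow hβ.ne']

theorem setOf_norm_sq_le_subset_ball {c : ℝ} (hc : c < 1) :
    {z : E | ‖z‖ ^ 2 ≤ c} ⊆ ball 0 1 := fun z hz => by
  rw [mem_ball_zero_iff]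
  exact (sq_lt_one_iff₀ (norm_nonneg z)).1 (lt_of_le_of_lt hz hc)

variable [InnerProductSpace ℝ E] [FiniteDimensional ℝ E]

theorem isCompact_setOf_norm_sq_le {c : ℝ} (hc : c < 1) : IsCompact {z : E | ‖z‖ ^ 2 ≤ c} :=
  (isCompact_closedBall 0 1).of_isClosed_subset (isClosed_le (by fun_prop) continuous_const)
    ((setOf_norm_sq_le_subset_ball hc).trans ball_subset_closedBall)

/-- Drop the negative term of the Laplacian; in the other one, the base grows to `1 - ‖z‖ ^ 2 ≤ 1`
and the exponent falls to `α - 2`. -/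
theorem laplacian_sub_norm_sq_rpow_le {α β c : ℝ} (hα : 2 ≤ α) (hαβ : α < β) (hβ : β ≤ α + 1)
    (hc : c ≤ 1) {z : E} (hz : z ∈ ball (0 : E) 1) :
    Δ (fun z : E => max (c - ‖z‖ ^ 2) 0 ^ β) z ≤
      4 * (α + 1) * α * (1 - ‖z‖ ^ 2) ^ (α - 2) := by
  rw [laplacian_sub_norm_sq_rpow (by linarith)]
  have hz1 : ‖z‖ ^ 2 < 1 := (sq_lt_one_iff₀ (norm_nonneg z)).2 (mem_ball_zero_iff.1 hz)
  have hs : max (c - ‖z‖ ^ 2) 0 ≤ 1 - ‖z‖ ^ 2 := max_le (by linarith) (by linarith)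
  have h1 : max (c - ‖z‖ ^ 2) 0 ^ (β - 2) ≤ (1 - ‖z‖ ^ 2) ^ (α - 2) :=
    (Real.rpow_le_rpow (le_max_right _ _) hs (by linarith)).trans
      (Real.rpow_le_rpow_of_exponent_ge (by linarith) (by simp) (by linarith))
  have h2 : 0 ≤ 2 * (finrank ℝ E) * β * max (c - ‖z‖ ^ 2) 0 ^ (β - 1) := by
    have : 0 ≤ β := by linarith
    positivity
  have h3 : 0 ≤ (1 - ‖z‖ ^ 2) ^ (α - 2) := Real.rpow_nonneg (by linarith) _
  calc _ ≤ 4 * β * (β - 1) * max (c - ‖z‖ ^ 2) 0 ^ (β - 2) * ‖z‖ ^ 2 := by linarith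
    _ ≤ 4 * (α + 1) * α * (1 - ‖z‖ ^ 2) ^ (α - 2) * 1 := by
        have : 0 ≤ β - 1 := by linarith
        have : β - 1 ≤ α := by linarith
        gcongr
    _ = _ := mul_one _

/-- Write `s = c - ‖z‖ ^ 2` and let `N` be the real dimension. Off the indicator's set, `s ≤ 1 / (4
+ 2 * N)`, hence `4 * ‖z‖ ^ 2 - 2 * N * s ≥ 3` and the positive term wins. On that set, which
depends on neither `c` nor `β`, the constant absorbs the negative term, at most `2 * N * (α + 1)`,
and the left side, at most `1`. -/
theorem rpow_le_laplacian_sub_norm_sq_rpow_add {α β c : ℝ} (hα : 2 ≤ α) (hαβ : α < β)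
    (hβ : β ≤ α + 1) (hc : 1 / 2 ≤ c) (hc1 : c ≤ 1) (z : E) :
    max (c - ‖z‖ ^ 2) 0 ^ (β - 2) ≤ Δ (fun z : E => max (c - ‖z‖ ^ 2) 0 ^ β) z +
      {z : E | ‖z‖ ^ 2 ≤ 1 - 1 / (4 + 2 * (finrank ℝ E : ℝ))}.indicator
        (fun _ => 2 * (finrank ℝ E) * (α + 1) + 1) z := by
  rw [laplacian_sub_norm_sq_rpow (by linarith)]
  set N : ℝ := (finrank ℝ E : ℝ)
  have hN : 0 ≤ N := by positivity
  have hK : 0 ≤ 2 * N * (α + 1) + 1 := by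
    have : 0 ≤ α + 1 := by linarith
    positivity
  rcases le_or_gt (c - ‖z‖ ^ 2) 0 with hs | hs
  · rw [max_eq_right hs, Real.zero_rpow (by linarith), Real.zero_rpow (by linarith)]
    simpa using Set.indicator_nonneg (fun _ _ => hK) z
  rw [max_eq_left hs.le]
  set s := c - ‖z‖ ^ 2 with hsdef
  have hz : ‖z‖ ^ 2 = c - s := by rw [hsdef]; ring
  have hz0 : 0 ≤ c - s := hz ▸ sq_nonneg ‖z‖
  have hpow : s ^ (β - 1) = s ^ (β - 2) * s := by
    rw [← Real.rpow_add_one hs.ne']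
    ring_nf
  have hP0 : 0 ≤ s ^ (β - 2) := Real.rpow_nonneg hs.le _
  have hP1 : s ^ (β - 2) ≤ 1 := Real.rpow_le_one hs.le (by linarith) (by linarith)
  rw [hz, hpow]
  set P := s ^ (β - 2)
  have hsplit : 4 * β * (β - 1) * P * (c - s) - 2 * N * β * (P * s) =
      P * (β * (4 * ((β - 1) * (c - s)) - 2 * N * s)) := by ring
  have hβ1 : c - s ≤ (β - 1) * (c - s) := by nlinarith
  by_cases hz' : z ∈ {z : E | ‖z‖ ^ 2 ≤ 1 - 1 / (4 + 2 * N)}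
  · rw [Set.indicator_of_mem hz']
    have h1 : 0 ≤ 4 * β * (β - 1) * P * (c - s) := by
      have : 0 ≤ β := by linarith
      have : 0 ≤ β - 1 := by linarith
      positivity
    have h2 : 2 * N * β * (P * s) ≤ 2 * N * (α + 1) * (1 * 1) := by
      have : 0 ≤ α + 1 := by linarith
      have : s ≤ 1 := by linarith
      gcongr
    linarith
  · rw [Set.indicator_of_notMem hz', add_zero, hsplit]
    have h1 : 1 - 1 / (4 + 2 * N) < c - s := by
      rw [Set.mem_ofPred_eq, not_le, hz] at hz'
      exact hz'
    have h2 : (4 + 2 * N) * s ≤ 1 := by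
      have : s ≤ 1 / (4 + 2 * N) := by linarith
      rw [le_div_iff₀ (by positivity)] at this
      linarith
    refine le_mul_of_one_le_right hP0 ?_
    have h3 : 1 ≤ 4 * ((β - 1) * (c - s)) - 2 * N * s := by linarith
    nlinarith

variable [MeasurableSpace E] [BorelSpace E]

theorem integrableOn_rpow_mul_laplacian_iff {μ : Measure E} [μ.IsAddHaarMeasure] {u : E → ℝ}
    (hu : ContDiffOn ℝ 2 u (ball 0 1)) (h0 : ∀ z ∈ ball (0 : E) 1, 0 ≤ u z)
    (hΔ : ∀ z ∈ ball (0 : E) 1, 0 ≤ Δ u z) {α : ℝ} (hα : 2 ≤ α) :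
    IntegrableOn (fun z => (1 - ‖z‖ ^ 2) ^ α * Δ u z) (ball 0 1) μ ↔
      IntegrableOn (fun z => (1 - ‖z‖ ^ 2) ^ (α - 2) * u z) (ball 0 1) μ := by
  -- The shift by `2` gives `ε k ≤ 1 / 2`, so that `c = 1 - ε k` and `β = α + ε k` satisfy the range
  -- conditions of both bounds.
  set ε : ℕ → ℝ := fun k => 1 / ((k : ℝ) + 2) with hε
  have hε0 (k : ℕ) : 0 < ε k := by positivity
  have hε2 (k : ℕ) : ε k ≤ 1 / 2 := by
    exact one_div_le_one_div_of_le two_pos (by simp)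
  have hεlim : Tendsto ε atTop (𝓝 0) := by
    simp only [hε, one_div]
    exact ((tendsto_natCast_atTop_atTop (R := ℝ)).atTop_add
      (tendsto_const_nhds (x := (2 : ℝ)))).inv_tendsto_atTop
  have hmeas : MeasurableSet (ball (0 : E) 1) := measurableSet_ball
  -- One parameter does two jobs: it pulls the support inside the ball and pushes the exponent above
  -- `2`, also when `α = 2`.
  set φ : ℕ → E → ℝ := fun k z => max (1 - ε k - ‖z‖ ^ 2) 0 ^ (α + ε k) with hφ
  have hφ2 (k : ℕ) : ContDiff ℝ 2 (φ k) :=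
    contDiff_two_sub_norm_sq_rpow (by linarith [hε0 k]) _
  have hts (k : ℕ) : tsupport (φ k) ⊆ {z | ‖z‖ ^ 2 ≤ 1 - ε k} :=
    tsupport_sub_norm_sq_rpow_subset (by linarith [hε0 k])
  have hsub (k : ℕ) : {z : E | ‖z‖ ^ 2 ≤ 1 - ε k} ⊆ ball 0 1 :=
    setOf_norm_sq_le_subset_ball (by linarith [hε0 k])
  have hcs (k : ℕ) : HasCompactSupport (φ k) :=
    (isCompact_setOf_norm_sq_le (by linarith [hε0 k])).of_isClosed_subset (isClosed_tsupport _)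
      (hts k)
  have hint1 (k : ℕ) : Integrable (fun z => φ k z * Δ u z) μ :=
    (hφ2 k).continuous.integrable_mul_of_tsupport_subset (hcs k) isOpen_ball
      ((hts k).trans (hsub k)) (hu.continuousOn_laplacian isOpen_ball)
  have hΔts (k : ℕ) : tsupport (Δ (φ k)) ⊆ tsupport (φ k) := by
    refine closure_minimal (fun z hz => ?_) (isClosed_tsupport _)
    by_contra h
    have := (laplacian_congr_nhds (notMem_tsupport_iff_eventuallyEq.1 h)).eq_of_nhds
    exact hz (this.trans (by
      rw [show (0 : E → ℝ) = fun _ => 0 from rfl, laplacian_const]; rfl))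
  have hint2 (k : ℕ) : Integrable (fun z => Δ (φ k) z * u z) μ :=
    (continuousOn_univ.1 ((hφ2 k).contDiffOn.continuousOn_laplacian
      isOpen_univ)).integrable_mul_of_tsupport_subset
      ((hcs k).of_isClosed_subset (isClosed_tsupport _) (hΔts k)) isOpen_ball
      ((hΔts k).trans ((hts k).trans (hsub k))) hu.continuousOn
  have hgreen (k : ℕ) : ∫ z in ball 0 1, φ k z * Δ u z ∂μ = ∫ z in ball 0 1, Δ (φ k) z * u z ∂μ := by
    have hout (z : E) (hz : z ∉ ball (0 : E) 1) : z ∉ tsupport (φ k) :=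
      fun h => hz (hsub k (hts k h))
    rw [setIntegral_eq_integral_of_forall_compl_eq_zero fun z hz => by
        rw [image_eq_zero_of_notMem_tsupport (hout z hz), zero_mul],
      setIntegral_eq_integral_of_forall_compl_eq_zero fun z hz => by
        rw [image_eq_zero_of_notMem_tsupport fun h => hout z hz (hΔts k h), zero_mul]]
    exact integral_mul_laplacian_of_tsupport_subset (hφ2 k) (hcs k) isOpen_ball
      ((hts k).trans (hsub k)) hu
  have hpos {z : E} (hz : z ∈ ball (0 : E) 1) : 0 < 1 - ‖z‖ ^ 2 :=
    sub_pos.2 ((sq_lt_one_iff₀ (norm_nonneg z)).2 (mem_ball_zero_iff.1 hz))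
  have hbase {z : E} (hz : z ∈ ball (0 : E) 1) :
      Tendsto (fun k => max (1 - ε k - ‖z‖ ^ 2) 0) atTop (𝓝 (1 - ‖z‖ ^ 2)) := by
    have : Tendsto (fun k => max (1 - ε k - ‖z‖ ^ 2) 0) atTop (𝓝 (max (1 - 0 - ‖z‖ ^ 2) 0)) :=
      ((tendsto_const_nhds.sub hεlim).sub tendsto_const_nhds).max tendsto_const_nhds
    rwa [sub_zero, max_eq_left (hpos hz).le] at this
  have hexp : Tendsto (fun k => α + ε k) atTop (𝓝 α) := by
    simpa using tendsto_const_nhds.add hεlim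
  constructor
  · intro h
    set A : Set E := {z : E | ‖z‖ ^ 2 ≤ 1 - 1 / (4 + 2 * (finrank ℝ E : ℝ))} with hA
    set K : ℝ := 2 * (finrank ℝ E) * (α + 1) + 1 with hK
    have hA1 : 1 - 1 / (4 + 2 * (finrank ℝ E : ℝ)) < 1 := sub_lt_self _ (by positivity)
    have hAsub : A ⊆ ball 0 1 := setOf_norm_sq_le_subset_ball hA1
    have hAc : IsCompact A := isCompact_setOf_norm_sq_le hA1
    have hAint : Integrable (fun z => A.indicator (fun _ => K) z * u z) μ := by
      have : IntegrableOn (fun z => K * u z) A μ :=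
        ((hu.continuousOn.mono hAsub).integrableOn_compact hAc).const_mul K
      refine (this.integrable_indicator hAc.measurableSet).congr
        (Eventually.of_forall fun z => ?_)
      by_cases hz : z ∈ A <;> simp [hz]
    have hint3 (k : ℕ) : Integrable (fun z => max (1 - ε k - ‖z‖ ^ 2) 0 ^ (α + ε k - 2) * u z)
        (μ.restrict (ball 0 1)) := by
      have hc : Continuous fun z : E => max (1 - ε k - ‖z‖ ^ 2) 0 ^ (α + ε k - 2) :=
        Continuous.rpow_const (by fun_prop) fun _ => .inr (by linarith [hε0 k])
      have ht : tsupport (fun z : E => max (1 - ε k - ‖z‖ ^ 2) 0 ^ (α + ε k - 2)) ⊆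
        {z | ‖z‖ ^ 2 ≤ 1 - ε k} := tsupport_sub_norm_sq_rpow_subset (by linarith [hε0 k])
      exact (hc.integrable_mul_of_tsupport_subset
        ((isCompact_setOf_norm_sq_le (by linarith [hε0 k])).of_isClosed_subset
          (isClosed_tsupport _) ht) isOpen_ball (ht.trans (hsub k)) hu.continuousOn).integrableOn
    refine integrable_of_tendsto_of_integral_le hint3
      (fun k => (ae_restrict_iff' hmeas).2 (Eventually.of_forall fun z hz =>
        mul_nonneg (by positivity) (h0 z hz)))
      (C := ∫ z in ball 0 1, (1 - ‖z‖ ^ 2) ^ α * Δ u z ∂μ +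
        ∫ z in ball 0 1, A.indicator (fun _ => K) z * u z ∂μ) (fun k => ?_)
      ((ae_restrict_iff' hmeas).2 (Eventually.of_forall fun z hz => ?_))
    · calc ∫ z in ball 0 1, max (1 - ε k - ‖z‖ ^ 2) 0 ^ (α + ε k - 2) * u z ∂μ
          ≤ ∫ z in ball 0 1, (Δ (φ k) z * u z + A.indicator (fun _ => K) z * u z) ∂μ := by
            refine setIntegral_mono_on (hint3 k)
              ((hint2 k).integrableOn.add hAint.integrableOn) hmeas fun z hz => ?_
            rw [← add_mul]
            exact mul_le_mul_of_nonneg_right (rpow_le_laplacian_sub_norm_sq_rpow_add hα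
              (by linarith [hε0 k]) (by linarith [hε2 k]) (by linarith [hε2 k])
              (by linarith [hε0 k]) z) (h0 z hz)
        _ = ∫ z in ball 0 1, φ k z * Δ u z ∂μ +
              ∫ z in ball 0 1, A.indicator (fun _ => K) z * u z ∂μ := by
            rw [integral_add (hint2 k).integrableOn hAint.integrableOn, hgreen k]
        _ ≤ _ := by
            refine add_le_add_left (setIntegral_mono_on (hint1 k).integrableOn h hmeas
              fun z hz => mul_le_mul_of_nonneg_right ?_ (hΔ z hz)) _
            have hs : max (1 - ε k - ‖z‖ ^ 2) 0 ≤ 1 - ‖z‖ ^ 2 :=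
              max_le (by linarith [hε0 k]) (hpos hz).le
            exact (Real.rpow_le_rpow (le_max_right _ _) hs (by linarith [hε0 k])).trans
              (Real.rpow_le_rpow_of_exponent_ge (hpos hz) (by simp) (by linarith [hε0 k]))
    · exact ((hbase hz).rpow (hexp.sub_const 2) (.inl (hpos hz).ne')).mul_const _
  · intro h
    refine integrable_of_tendsto_of_integral_le (fun k => (hint1 k).integrableOn)
      (fun k => (ae_restrict_iff' hmeas).2 (Eventually.of_forall fun z hz =>
        mul_nonneg (by positivity) (hΔ z hz)))
      (C := ∫ z in ball 0 1, 4 * (α + 1) * α * ((1 - ‖z‖ ^ 2) ^ (α - 2) * u z) ∂μ) (fun k => ?_)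
      ((ae_restrict_iff' hmeas).2 (Eventually.of_forall fun z hz => ?_))
    · rw [hgreen k]
      refine setIntegral_mono_on (hint2 k).integrableOn (h.const_mul _) hmeas fun z hz => ?_
      rw [← mul_assoc]
      exact mul_le_mul_of_nonneg_right (laplacian_sub_norm_sq_rpow_le hα
        (by linarith [hε0 k]) (by linarith [hε2 k]) (by linarith [hε0 k]) hz) (h0 z hz)
    · exact ((hbase hz).rpow hexp (.inl (hpos hz).ne')).mul_const _

end Ball

/-! ### Boundary distance, normalized volume and the Bergman norm. -/

theorem infDist_sphere_zero_one {E : Type*} [NormedAddCommGroup E] [NormedSpace ℝ E] [Nontrivial E]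
    {z : E} (hz : z ∈ ball (0 : E) 1) : infDist z (sphere 0 1) = 1 - ‖z‖ := by
  have hz1 : ‖z‖ < 1 := mem_ball_zero_iff.1 hz
  refine le_antisymm ?_ ?_
  · rcases eq_or_ne z 0 with rfl | h
    · obtain ⟨w, hw⟩ := NormedSpace.sphere_nonempty (E := E) (x := 0) (r := 1) |>.2 zero_le_one
      have : ‖w‖ = 1 := by simpa using hw
      simpa [this] using infDist_le_dist_of_mem (x := (0 : E)) hw
    · have hn : ‖z‖ ≠ 0 := norm_ne_zero_iff.2 h
      have hw : ‖z‖⁻¹ • z ∈ sphere (0 : E) 1 := by simp [norm_smul, hn]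
      refine (infDist_le_dist_of_mem hw).trans_eq ?_
      rw [dist_eq_norm, ← norm_neg, neg_sub]
      have : ‖z‖⁻¹ • z - z = (‖z‖⁻¹ - 1) • z := by rw [sub_smul, one_smul]
      rw [this, norm_smul, Real.norm_of_nonneg (sub_nonneg.2 ((one_le_inv₀ (by positivity)).2 hz1.le)),
        sub_mul, inv_mul_cancel₀ hn, one_mul]
  · refine (le_infDist (NormedSpace.sphere_nonempty.2 zero_le_one)).2 fun w hw => ?_
    have hw1 : ‖w‖ = 1 := by simpa using hw
    have := norm_sub_norm_le w z
    rw [dist_comm, dist_eq_norm]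
    linarith

theorem bdryDist_eq {n : ℕ} (hn : 1 ≤ n) {z : EuclideanSpace ℂ (Fin n)} (hz : z ∈ unitBall n) :
    bdryDist z = 1 - ‖z‖ := by
  have : Nonempty (Fin n) := ⟨⟨0, hn⟩⟩
  have : Nontrivial (EuclideanSpace ℂ (Fin n)) := inferInstance
  rw [bdryDist, unitBall, frontier_ball _ one_ne_zero]
  exact infDist_sphere_zero_one hz

theorem integrable_normVol_iff {n : ℕ} {g : EuclideanSpace ℂ (Fin n) → ℝ} :
    Integrable g (normVol n) ↔ IntegrableOn g (unitBall n) := by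
  rw [normVol, IntegrableOn]
  refine integrable_smul_measure (ENNReal.inv_ne_zero.2 measure_ball_lt_top.ne) ?_
  exact ENNReal.inv_ne_top.2 (measure_ball_pos _ _ one_pos).ne'

theorem lintegral_normVol_lt_top_iff {n : ℕ} {g : EuclideanSpace ℂ (Fin n) → ℝ}
    (hg : ContinuousOn g (unitBall n)) (h0 : ∀ z ∈ unitBall n, 0 ≤ g z) :
    ∫⁻ z, ENNReal.ofReal (g z) ∂(normVol n) < ∞ ↔ IntegrableOn g (unitBall n) := by
  have hm : AEStronglyMeasurable g (normVol n) :=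
    (hg.aestronglyMeasurable measurableSet_ball).smul_measure _
  rw [← integrable_normVol_iff, Integrable, hasFiniteIntegral_iff_ofReal]
  · simp [hm]
  · exact Measure.ae_smul_measure ((ae_restrict_iff' measurableSet_ball).2
      (Eventually.of_forall h0)) _

/-- On the ball, `1 - ‖z‖ ≤ 1 - ‖z‖ ^ 2 ≤ 2 * (1 - ‖z‖)`. -/
theorem integrableOn_one_sub_norm_sq_rpow_mul_iff {E : Type*} [NormedAddCommGroup E]
    [MeasurableSpace E] [BorelSpace E] {μ : Measure E} {u : E → ℝ}
    (hu : ContinuousOn u (ball 0 1)) {ν : ℝ} (hν : 0 ≤ ν) :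
    IntegrableOn (fun z => (1 - ‖z‖ ^ 2) ^ ν * u z) (ball 0 1) μ ↔
      IntegrableOn (fun z => (1 - ‖z‖) ^ ν * u z) (ball 0 1) μ := by
  have h1 : ContinuousOn (fun z => (1 - ‖z‖ ^ 2) ^ ν * u z) (ball 0 1) :=
    (Continuous.rpow_const (by fun_prop) fun _ => .inr hν).continuousOn.mul hu
  have h2 : ContinuousOn (fun z => (1 - ‖z‖) ^ ν * u z) (ball 0 1) :=
    (Continuous.rpow_const (by fun_prop) fun _ => .inr hν).continuousOn.mul hu
  have key (z : E) (hz : z ∈ ball (0 : E) 1) : 0 ≤ 1 - ‖z‖ ∧ 1 - ‖z‖ ≤ 1 - ‖z‖ ^ 2 ∧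
      1 - ‖z‖ ^ 2 ≤ 2 * (1 - ‖z‖) := by
    have := mem_ball_zero_iff.1 hz
    have := norm_nonneg z
    refine ⟨by linarith, by nlinarith, by nlinarith⟩
  constructor <;> intro h
  · refine Integrable.mono h (h2.aestronglyMeasurable measurableSet_ball)
      ((ae_restrict_iff' measurableSet_ball).2 (Eventually.of_forall fun z hz => ?_))
    obtain ⟨h0, h1, -⟩ := key z hz
    rw [norm_mul, norm_mul, Real.norm_of_nonneg (Real.rpow_nonneg h0 _),
      Real.norm_of_nonneg (Real.rpow_nonneg (h0.trans h1) _)]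
    gcongr
  · refine Integrable.mono (h.const_mul (2 ^ ν)) (h1.aestronglyMeasurable measurableSet_ball)
      ((ae_restrict_iff' measurableSet_ball).2 (Eventually.of_forall fun z hz => ?_))
    obtain ⟨h0, h1, h2⟩ := key z hz
    rw [← mul_assoc, ← Real.mul_rpow zero_le_two h0, norm_mul, norm_mul,
      Real.norm_of_nonneg (Real.rpow_nonneg (by linarith) _),
      Real.norm_of_nonneg (Real.rpow_nonneg (by linarith) _)]
    gcongr
    linarith

theorem mem_bergmanSpace_iff {n : ℕ} (hn : 1 ≤ n) {f : EuclideanSpace ℂ (Fin n) → ℂ}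
    (hf : ContinuousOn f (unitBall n)) {ν p : ℝ} (hν : 0 ≤ ν) (hp : 0 < p) :
    f ∈ bergmanSpace n ν p ↔ IntegrableOn (fun z => (1 - ‖z‖ ^ 2) ^ ν * ‖f z‖ ^ p) (unitBall n) := by
  have hfp : ContinuousOn (fun z => ‖f z‖ ^ p) (unitBall n) :=
    hf.norm.rpow_const fun _ _ => .inr hp.le
  have hc : ContinuousOn (fun z => (1 - ‖z‖) ^ ν * ‖f z‖ ^ p) (unitBall n) :=
    (Continuous.rpow_const (by fun_prop) fun _ => .inr hν).continuousOn.mul hfp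
  have hnn : ∀ z ∈ unitBall n, 0 ≤ (1 - ‖z‖) ^ ν * ‖f z‖ ^ p := fun z hz =>
    mul_nonneg (Real.rpow_nonneg (by linarith [mem_ball_zero_iff.1 hz]) _) (by positivity)
  have hl : ∫⁻ z, ENNReal.ofReal (bdryDist z ^ ν * ‖f z‖ ^ p) ∂(normVol n) =
      ∫⁻ z, ENNReal.ofReal ((1 - ‖z‖) ^ ν * ‖f z‖ ^ p) ∂(normVol n) := by
    refine lintegral_congr_ae (Measure.ae_smul_measure ((ae_restrict_iff' measurableSet_ball).2
      (Eventually.of_forall fun z hz => ?_)) _)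
    simp only [bdryDist_eq hn hz]
  rw [unitBall, integrableOn_one_sub_norm_sq_rpow_mul_iff hfp hν, ← unitBall,
    ← lintegral_normVol_lt_top_iff hc hnn, ← hl, bergmanSpace, Set.mem_ofPred_eq, bergmanNorm,
    ENNReal.add_lt_top, ENNReal.rpow_lt_top_iff_of_pos (by positivity)]
  simp [hf]

theorem mainTheorem2 (n : ℕ) (hn : 1 ≤ n) (f : EuclideanSpace ℂ (Fin n) → ℂ)
    (hf : ContDiffOn ℝ 2 f (unitBall n))
    (hΔ : ∀ z ∈ unitBall n, 0 ≤ (f z * conj (Δ f z)).re)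
    (p α : ℝ) (hp : 2 ≤ p) (hα : 2 ≤ α) :
    Integrable (fun z : EuclideanSpace ℂ (Fin n) =>
        (1 - ‖z‖ ^ 2) ^ α * Δ (fun w : EuclideanSpace ℂ (Fin n) => ‖f w‖ ^ p) z) (normVol n) ↔
      f ∈ bergmanSpace n (α - 2) p := by
  rw [mem_bergmanSpace_iff hn hf.continuousOn (by linarith) (by linarith), integrable_normVol_iff]
  refine integrableOn_rpow_mul_laplacian_iff ((contDiff_two_norm_rpow hp).comp_contDiffOn hf)
    (fun z _ => Real.rpow_nonneg (norm_nonneg _) _) (fun z hz => ?_) hα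
  refine (hf.contDiffAt (isOpen_ball.mem_nhds hz)).laplacian_norm_rpow_nonneg hp ?_
  -- The sign hypothesis says that the real inner product of `f z` and `Δ f z` in `ℂ` is
  -- nonnegative.
  rw [real_inner_comm, Complex.inner]
  exact hΔ z hz
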